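/- Let $G$ be an abelian group. For finite sets $X, Y \subseteq G$ and an integer $i \ge 1$, let $X +_i Y$ denote the set of all $g \in G$ having at least $i$ representations $g = x + y$ with $x \in X$, $y \in Y$ (so that $X +_1 Y = X + Y$ is the ordinary sumset). Let $A, B \subseteq G$ be finite with $|A|, |B| \ge 2$. Then either $$|A +_1 B| + |A +_2 B| \ge 2|A| + 2|B| - 4,$$ or else the stabilizer $H = \{x \in G : x + (A +_2 B) = A +_2 B\}$ of $A +_2 B$ is nontrivial and there exist $A' \subseteq A$ and $B' \subseteq B$ such that $$l := |A \setminus A'| + |B \setminus B'| \le 1,$$ $$A' +_2 B' = A' + B' = A +_2 B,$$ and $$|A +_1 B| + |A +_2 B| \ge 2|A| + 2|B| - (2 - l)(|H| - \rho) - 2l \ge 2|A| + 2|B| - 2|H|,$$ where $\rho = |A' + H| - |A'| + |B' + H| - |B'|$. -/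

import Mathlib

open scoped Pointwise

namespace Pollard

/-- `repSums A B i` is the set of all `g` with at least `i` representations `g = a + b`,
`a ∈ A`, `b ∈ B`, for `i ≥ 1` (such `g` automatically lie in `A + B`, see `mem_repSums`).
`Finset.addConvolution A B g` is the number of pairs `(a, b) ∈ A × B` with `a + b = g`. -/
def repSums {G : Type*} [AddCommGroup G] [DecidableEq G] (A B : Finset G) (i : ℕ) : Finset G :=
  (A + B).filter (fun g => i ≤ Finset.addConvolution A B g)

theorem mem_repSums {G : Type*} [AddCommGroup G] [DecidableEq G] (A B : Finset G) {i : ℕ}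
    (hi : 1 ≤ i) (g : G) : g ∈ repSums A B i ↔ i ≤ Finset.addConvolution A B g := by
  unfold repSums
  rw [Finset.mem_filter]
  refine ⟨fun h => h.2, fun h => ⟨?_, h⟩⟩
  by_contra hg
  have h0 : Finset.addConvolution A B g = 0 := by
    rw [Finset.addConvolution, Finset.card_eq_zero, Finset.filter_eq_empty_iff]
    rintro ⟨a, b⟩ hab hs
    rw [Finset.mem_product] at hab
    exact hg (hs ▸ Finset.add_mem_add hab.1 hab.2)
  omega

/-- The stabilizer `{x ∈ G | x + S = S}` of a finite set `S`. -/
abbrev stab {G : Type*} [AddCommGroup G] [DecidableEq G] (S : Finset G) : AddSubgroup G :=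
  AddAction.stabilizer G S

theorem mem_stab {G : Type*} [AddCommGroup G] [DecidableEq G] (S : Finset G) (x : G) :
    x ∈ stab S ↔ S.image (fun s => x + s) = S :=
  Iff.rfl

/-- The number `|A + H| - |A|` of `H`-holes of a finite set `A`. -/
noncomputable def holes {G : Type*} [AddCommGroup G] (H : AddSubgroup G) (A : Finset G) : ℤ :=
  (((A : Set G) + (H : Set G)).ncard : ℤ) - (A.card : ℤ)

end Pollard

/-! Let N be the number of representations with each element counted at most twice, so N = |A +_1 B|
+ |A +_2 B|. The core is a dichotomy: either N ≥ 2|A| + 2|B| - 4, or deleting at most one element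
from one set leaves a pair A', B' whose sumset has no unique expression element
(`le_truncCount_or_nearlyNoUnique`).

The dichotomy goes by induction on |A||B|. In a counterexample each element of A or B lies in at
most one unique expression element (`eq_of_addConvolution_eq_one`): otherwise deleting it lowers N
by two, and induction applies. Translate B so that A ∩ B is nonempty and smaller than B. Pollard's
identity shows that passing to (A ∪ B, A ∩ B) keeps |A| + |B| and raises no representation count,
while |A||B| drops; if A ∩ B is a single point, the identity bounds N directly. If induction only
yields an exceptional pair with a deleted element, count what that element adds outside the
remaining sumset P.

All such counts combine Kneser's theorem |P| ≥ |A' + H| + |B' + H| - |H|, with H the stabilizer of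
P, and the fact that a translate of B' leaving P has at least |H| - (|B' + H| - |B'|) elements
outside P (`card_period_add_card_le`): the holes lost there are regained in Kneser's bound. The same
count turns an exceptional pair into the stated structure. -/

namespace Pollard

variable {G : Type*} [AddCommGroup G] [DecidableEq G]

/-! ### Kneser's theorem -/

/-- The stabilizer of a finite set as a finite set (empty if the set is empty). -/
def period (S : Finset G) : Finset G :=
  (S - S).filter (fun x => ∀ s ∈ S, x + s ∈ S)

theorem add_mem_of_mem_period {S : Finset G} {x s : G} (hx : x ∈ period S) (hs : s ∈ S) :
    x + s ∈ S :=
  (Finset.mem_filter.1 hx).2 s hs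

theorem mem_period {S : Finset G} (hS : S.Nonempty) {x : G} :
    x ∈ period S ↔ ∀ s ∈ S, x + s ∈ S := by
  refine ⟨fun h => (Finset.mem_filter.1 h).2, fun h => Finset.mem_filter.2 ⟨?_, h⟩⟩
  obtain ⟨s, hs⟩ := hS
  exact Finset.mem_sub.2 ⟨x + s, h s hs, s, hs, by abel⟩

theorem zero_mem_period {S : Finset G} (hS : S.Nonempty) : (0 : G) ∈ period S :=
  (mem_period hS).2 fun s hs => by simpa using hs

theorem period_nonempty {S : Finset G} (hS : S.Nonempty) : (period S).Nonempty :=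
  ⟨0, zero_mem_period hS⟩

theorem nonempty_of_mem_period {S : Finset G} {x : G} (hx : x ∈ period S) : S.Nonempty := by
  obtain ⟨s, hs, -⟩ := Finset.mem_sub.1 (Finset.mem_filter.1 hx).1
  exact ⟨s, hs⟩

theorem add_mem_period {S : Finset G} {x y : G} (hx : x ∈ period S) (hy : y ∈ period S) :
    x + y ∈ period S :=
  (mem_period (nonempty_of_mem_period hx)).2 fun s hs => by
    rw [add_assoc]
    exact add_mem_of_mem_period hx (add_mem_of_mem_period hy hs)

theorem vadd_eq_of_mem_period {S : Finset G} {x : G} (hx : x ∈ period S) : x +ᵥ S = S := by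
  refine Finset.eq_of_subset_of_card_le ?_ (by simp)
  intro y hy
  obtain ⟨s, hs, rfl⟩ := Finset.mem_vadd_finset.1 hy
  exact add_mem_of_mem_period hx hs

theorem neg_mem_period {S : Finset G} {x : G} (hx : x ∈ period S) : -x ∈ period S :=
  (mem_period (nonempty_of_mem_period hx)).2 fun s hs => by
    rw [← vadd_eq_of_mem_period hx] at hs
    obtain ⟨t, ht, rfl⟩ := Finset.mem_vadd_finset.1 hs
    simpa using ht

theorem add_mem_iff_of_mem_period {S : Finset G} {x s : G} (hx : x ∈ period S) :
    s + x ∈ S ↔ s ∈ S := by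
  refine ⟨fun h => ?_, fun h => by rw [add_comm]; exact add_mem_of_mem_period hx h⟩
  simpa using add_mem_of_mem_period (neg_mem_period hx) h

theorem add_period (S : Finset G) : S + period S = S := by
  refine Finset.Subset.antisymm ?_ ?_
  · intro y hy
    obtain ⟨s, hs, x, hx, rfl⟩ := Finset.mem_add.1 hy
    exact (add_mem_iff_of_mem_period hx).2 hs
  · intro s hs
    exact Finset.mem_add.2 ⟨s, hs, 0, zero_mem_period ⟨s, hs⟩, add_zero s⟩

theorem subset_add_period (A : Finset G) {S : Finset G} (hS : S.Nonempty) : A ⊆ A + period S :=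
  fun a ha => Finset.mem_add.2 ⟨a, ha, 0, zero_mem_period hS, add_zero a⟩

/-- Counting in a coset of the sum of two stabilizers. -/
theorem card_mul_card_le_of_periods (C D : Finset G) (x : G) :
    ((period C).filter (fun y => x + y ∈ D)).card * ((period D).filter (fun y => x + y ∉ C)).card
      ≤ (period C ∩ period D).card * (D \ C).card := by
  rw [← Finset.card_product]
  refine Finset.card_le_mul_card_image_of_maps_to (f := fun q : G × G => x + q.1 + q.2) ?_ _ ?_
  · rintro ⟨y, z⟩ hq
    obtain ⟨hq1, hq2⟩ := Finset.mem_product.1 hq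
    obtain ⟨hy, hyD⟩ := Finset.mem_filter.1 hq1
    obtain ⟨hz, hzC⟩ := Finset.mem_filter.1 hq2
    refine Finset.mem_sdiff.2 ⟨(add_mem_iff_of_mem_period hz).2 hyD, fun h => hzC ?_⟩
    rw [add_right_comm] at h
    exact (add_mem_iff_of_mem_period hy).1 h
  · intro g _
    rcases Finset.eq_empty_or_nonempty (Finset.filter (fun q : G × G => x + q.1 + q.2 = g)
      ((period C).filter (fun y => x + y ∈ D) ×ˢ (period D).filter (fun y => x + y ∉ C)))
      with h | ⟨p, hp⟩
    · rw [h]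
      simp
    simp only [Finset.mem_filter, Finset.mem_product] at hp
    obtain ⟨⟨⟨hp1, -⟩, hp2, -⟩, hpg⟩ := hp
    refine Finset.card_le_card_of_injOn (fun q => q.1 - p.1) ?_ ?_
    · intro q hq
      simp only [Finset.mem_filter, Finset.mem_product, Finset.mem_coe] at hq
      obtain ⟨⟨⟨hq1, -⟩, hq2, -⟩, hqg⟩ := hq
      have h2 : q.1 - p.1 = p.2 + -q.2 := by
        rw [← hpg, add_assoc, add_assoc, add_right_inj] at hqg
        rw [sub_eq_iff_eq_add, add_right_comm, ← sub_eq_add_neg, eq_sub_iff_add_eq, hqg]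
        abel
      refine Finset.mem_coe.2 (Finset.mem_inter.2 ⟨?_, ?_⟩)
      · change q.1 - p.1 ∈ period C
        rw [sub_eq_add_neg]
        exact add_mem_period hq1 (neg_mem_period hp1)
      · change q.1 - p.1 ∈ period D
        rw [h2]
        exact add_mem_period hp2 (neg_mem_period hq2)
    · intro q hq q' hq' h
      simp only [Finset.mem_filter, Finset.mem_product, Finset.mem_coe] at hq hq'
      have h1 : q.1 = q'.1 := sub_left_injective h
      refine Prod.ext h1 ?_
      have h2 := hq.2.trans hq'.2.symm
      rw [h1] at h2
      exact add_left_cancel h2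

/-- Double counting in the coset of c modulo the sum of the two stabilizers: the grid bound holds
for D \ C and, with the roles exchanged, for C \ D, and failure of all three alternatives makes the
two bounds incompatible. -/
theorem card_period_le_of_mem_sdiff {C D : Finset G} {c : G} (hc : c ∈ D \ C) :
    (period C).card ≤ (D \ C).card + (period C ∩ period D).card ∨
    (period D).card ≤ (C \ D).card + (period C ∩ period D).card ∨
    (period D).card ≤ (D \ C).card := by
  obtain ⟨hcD, hcC⟩ := Finset.mem_sdiff.1 hc
  by_contra! hcon
  obtain ⟨hg1, hg2, hg3⟩ := hcon
  set K := period C ∩ period D with hK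
  have hg := card_mul_card_le_of_periods C D c
  have hg' := card_mul_card_le_of_periods D C c
  rw [← hK] at hg
  rw [Finset.inter_comm, ← hK] at hg'
  have hs := Finset.card_filter_add_card_filter_not (s := period C) (fun y => c + y ∈ D)
  have ht := Finset.card_filter_add_card_filter_not (s := period D) (fun y => c + y ∈ C)
  set s := ((period C).filter (fun y => c + y ∈ D)).card with hsd
  set s' := ((period C).filter (fun y => c + y ∉ D)).card with hsd'
  set t := ((period D).filter (fun y => c + y ∈ C)).card with htd
  set t' := ((period D).filter (fun y => c + y ∉ C)).card with htd'
  have hKs : K.card ≤ s := Finset.card_le_card fun x hx => by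
    rw [hK, Finset.mem_inter] at hx
    exact Finset.mem_filter.2 ⟨hx.1, (add_mem_iff_of_mem_period hx.2).2 hcD⟩
  have hKt' : K.card ≤ t' := Finset.card_le_card fun x hx => by
    rw [hK, Finset.mem_inter] at hx
    exact Finset.mem_filter.2 ⟨hx.2, fun h => hcC ((add_mem_iff_of_mem_period hx.1).1 h)⟩
  have hKs' : s' = 0 ∨ K.card ≤ s' := by
    rcases Nat.eq_zero_or_pos s' with h | h
    · exact Or.inl h
    obtain ⟨y, hy⟩ := Finset.card_pos.1 h
    obtain ⟨hy1, hy2⟩ := Finset.mem_filter.1 hy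
    right
    rw [← Finset.card_vadd_finset y K]
    refine Finset.card_le_card fun z hz => ?_
    obtain ⟨x, hx, rfl⟩ := Finset.mem_vadd_finset.1 hz
    rw [hK, Finset.mem_inter] at hx
    refine Finset.mem_filter.2 ⟨add_mem_period hy1 hx.1, fun h => hy2 ?_⟩
    rwa [vadd_eq_add, ← add_assoc, add_mem_iff_of_mem_period hx.2] at h
  have hKt : t = 0 ∨ K.card ≤ t := by
    rcases Nat.eq_zero_or_pos t with h | h
    · exact Or.inl h
    obtain ⟨y, hy⟩ := Finset.card_pos.1 h
    obtain ⟨hy1, hy2⟩ := Finset.mem_filter.1 hy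
    right
    rw [← Finset.card_vadd_finset y K]
    refine Finset.card_le_card fun z hz => ?_
    obtain ⟨x, hx, rfl⟩ := Finset.mem_vadd_finset.1 hz
    rw [hK, Finset.mem_inter] at hx
    refine Finset.mem_filter.2 ⟨add_mem_period hy1 hx.2, ?_⟩
    rwa [vadd_eq_add, ← add_assoc, add_mem_iff_of_mem_period hx.1]
  -- If C is empty, its period is empty by convention, and the negated first alternative is absurd.
  have hK0 : 0 < K.card := Finset.card_pos.2 ⟨0, by
    rw [hK, Finset.mem_inter]
    refine ⟨zero_mem_period ?_, zero_mem_period ⟨c, hcD⟩⟩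
    by_contra hne
    rw [Finset.not_nonempty_iff_eq_empty] at hne
    subst hne
    simp [period] at hg1⟩
  clear_value K s s' t t'
  rcases hKs' with h | hKs'
  · have h1 : K.card * s ≤ K.card * (D \ C).card := by nlinarith
    have h2 := Nat.le_of_mul_le_mul_left h1 hK0
    omega
  rcases hKt with h | hKt
  · have h1 : K.card * t' ≤ K.card * (D \ C).card := by nlinarith
    have h2 := Nat.le_of_mul_le_mul_left h1 hK0
    omega
  obtain ⟨p, rfl⟩ := Nat.exists_eq_add_of_le hKs
  obtain ⟨p', rfl⟩ := Nat.exists_eq_add_of_le hKs'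
  obtain ⟨q, rfl⟩ := Nat.exists_eq_add_of_le hKt
  obtain ⟨q', rfl⟩ := Nat.exists_eq_add_of_le hKt'
  generalize (D \ C).card = d at *
  generalize (C \ D).card = e at *
  generalize K.card = k at *
  have hd : d + 1 ≤ k + p + p' := by omega
  have he : e + 1 ≤ k + q + q' := by omega
  -- Expanding the two bounds forces q' < p' and p' < q'.
  have h1 : (k + p) * (k + q') + k ≤ k * (k + p + p') := by
    linarith [Nat.mul_le_mul_left k hd]
  have h2 : (k + q) * (k + p') + k ≤ k * (k + q + q') := by
    linarith [Nat.mul_le_mul_left k he]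
  have h3 : p * q' + k * q' + k ≤ k * p' := by linarith
  have h4 : q * p' + k * p' + k ≤ k * q' := by linarith
  linarith [Nat.zero_le (p * q'), Nat.zero_le (q * p')]

/-- Kneser's bound survives unions, which makes a maximal subset satisfying it the whole sumset. The
intersection of the two periods stabilizes the union. If it is too small to suffice, each set has
period at most its part outside the other, and the larger of those parts settles the claim. -/
theorem le_card_union_add_card_period {C D : Finset G} {m : ℕ} (hC : C.Nonempty)
    (hmC : m ≤ C.card + (period C).card) (hmD : m ≤ D.card + (period D).card) :
    m ≤ (C ∪ D).card + (period (C ∪ D)).card := by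
  by_cases hCD : C ⊆ D
  · rwa [Finset.union_eq_right.2 hCD]
  by_cases hDC : D ⊆ C
  · rwa [Finset.union_eq_left.2 hDC]
  obtain ⟨c, hc⟩ := Finset.sdiff_nonempty.2 hCD
  obtain ⟨d, hd⟩ := Finset.sdiff_nonempty.2 hDC
  have h1 := card_period_le_of_mem_sdiff hc
  have h2 := card_period_le_of_mem_sdiff hd
  rw [Finset.inter_comm (period D)] at h1
  have h3 : (period C ∩ period D).card ≤ (period (C ∪ D)).card := by
    refine Finset.card_le_card fun x hx => ?_
    rw [Finset.mem_inter] at hx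
    refine (mem_period (hC.mono Finset.subset_union_left)).2 fun s hs => ?_
    rcases Finset.mem_union.1 hs with hs | hs
    · exact Finset.mem_union_left _ (add_mem_of_mem_period hx.1 hs)
    · exact Finset.mem_union_right _ (add_mem_of_mem_period hx.2 hs)
  have h4 : (C ∪ D).card = C.card + (D \ C).card := by
    rw [← Finset.union_sdiff_self_eq_union, Finset.card_union_of_disjoint Finset.disjoint_sdiff]
  have h5 : (C ∪ D).card = D.card + (C \ D).card := by
    rw [Finset.union_comm, ← Finset.union_sdiff_self_eq_union,
      Finset.card_union_of_disjoint Finset.disjoint_sdiff]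
  omega

/-- Every element of a sumset lies in a subset of the sumset that satisfies Kneser's bound. -/
theorem exists_subset_add_le_card_add_card_period (A B : Finset G) {a b : G} (ha : a ∈ A)
    (hb : b ∈ B) : ∃ C ⊆ A + B, a + b ∈ C ∧ A.card + B.card ≤ C.card + (period C).card := by
  suffices h : ∀ (n : ℕ) (A B : Finset G) (a : G), B.card = n → a ∈ A → (0 : G) ∈ B →
      ∃ C ⊆ A + B, a ∈ C ∧ A.card + B.card ≤ C.card + (period C).card by
    obtain ⟨C, hC, hab, hc⟩ := h _ (b +ᵥ A) (-b +ᵥ B) (a + b) rfl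
      (Finset.mem_vadd_finset.2 ⟨a, ha, by rw [vadd_eq_add, add_comm]⟩)
      (Finset.mem_vadd_finset.2 ⟨b, hb, by simp⟩)
    refine ⟨C, ?_, hab, by simpa using hc⟩
    rwa [vadd_add_assoc, add_vadd_comm, vadd_vadd, add_neg_cancel, zero_vadd] at hC
  intro n
  induction n using Nat.strong_induction_on with
  | _ n ih =>
    rintro A B a rfl ha h0
    -- Terminal case of the e-transform: B stabilizes A, so C = A works. Otherwise move the part of
    -- e + B outside A from B into A; this keeps 0 ∈ B and the total size.
    by_cases h : ∀ e ∈ A, ∀ b ∈ B, e + b ∈ A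
    · refine ⟨A, fun x hx => Finset.mem_add.2 ⟨x, hx, 0, h0, add_zero x⟩, ha, ?_⟩
      have hB : B ⊆ period A := fun b hb => (mem_period ⟨a, ha⟩).2 fun s hs => by
        rw [add_comm]
        exact h s hs b hb
      exact Nat.add_le_add_left (Finset.card_le_card hB) _
    push Not at h
    obtain ⟨e, he, b', hb', heb⟩ := h
    have hcard := Finset.card_filter_add_card_filter_not (s := B) (fun y => e + y ∈ A)
    have hlt : 0 < (B.filter (fun y => e + y ∉ A)).card :=
      Finset.card_pos.2 ⟨b', Finset.mem_filter.2 ⟨hb', heb⟩⟩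
    obtain ⟨C, hC, haC, hc⟩ := ih (B.filter (fun y => e + y ∈ A)).card (by omega)
      (A ∪ (e +ᵥ B.filter (fun y => e + y ∉ A))) (B.filter (fun y => e + y ∈ A)) a rfl
      (Finset.mem_union_left _ ha) (Finset.mem_filter.2 ⟨h0, by simpa using he⟩)
    refine ⟨C, hC.trans ?_, haC, ?_⟩
    · intro x hx
      obtain ⟨u, hu, v, hv, rfl⟩ := Finset.mem_add.1 hx
      obtain ⟨hvB, hvA⟩ := Finset.mem_filter.1 hv
      rcases Finset.mem_union.1 hu with hu | hu
      · exact Finset.add_mem_add hu hvB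
      · obtain ⟨y, hy, rfl⟩ := Finset.mem_vadd_finset.1 hu
        rw [vadd_eq_add, add_right_comm]
        exact Finset.add_mem_add hvA (Finset.mem_filter.1 hy).1
    · rw [Finset.card_union_of_disjoint, Finset.card_vadd_finset] at hc
      · omega
      · refine Finset.disjoint_left.2 fun x hxA hx => ?_
        obtain ⟨y, hy, rfl⟩ := Finset.mem_vadd_finset.1 hx
        exact (Finset.mem_filter.1 hy).2 hxA

theorem card_add_card_le_card_add_add_card_period {A B : Finset G} (hA : A.Nonempty)
    (hB : B.Nonempty) : A.card + B.card ≤ (A + B).card + (period (A + B)).card := by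
  classical
  obtain ⟨a, ha⟩ := hA
  obtain ⟨b, hb⟩ := hB
  obtain ⟨C, hC, hab, hC'⟩ := exists_subset_add_le_card_add_card_period A B ha hb
  obtain ⟨M, hM, hmax⟩ := Finset.exists_max_image ((A + B).powerset.filter
    (fun C => C.Nonempty ∧ A.card + B.card ≤ C.card + (period C).card)) Finset.card
    ⟨C, Finset.mem_filter.2 ⟨Finset.mem_powerset.2 hC, ⟨_, hab⟩, hC'⟩⟩
  simp only [Finset.mem_filter, Finset.mem_powerset] at hM hmax
  obtain ⟨hMs, hMn, hMc⟩ := hM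
  suffices h : A + B ⊆ M by rwa [Finset.Subset.antisymm h hMs]
  intro x hx
  obtain ⟨a', ha', b', hb', rfl⟩ := Finset.mem_add.1 hx
  obtain ⟨D, hD, habD, hD'⟩ := exists_subset_add_le_card_add_card_period A B ha' hb'
  have h1 := hmax (M ∪ D) ⟨Finset.union_subset hMs hD, hMn.mono Finset.subset_union_left,
    le_card_union_add_card_period hMn hMc hD'⟩
  rw [Finset.eq_of_subset_of_card_le Finset.subset_union_left h1]
  exact Finset.mem_union_right _ habD

/-- **Kneser's theorem**. -/
theorem kneser {A B : Finset G} (hA : A.Nonempty) (hB : B.Nonempty) :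
    (A + period (A + B)).card + (B + period (A + B)).card ≤
      (A + B).card + (period (A + B)).card := by
  -- Passing to A + H and B + H does not change the sumset, so the weak form applied to them is the
  -- strong form.
  have hH := period_nonempty (hA.add hB)
  have h := card_add_card_le_card_add_add_card_period (hA.add hH) (hB.add hH)
  have h2 : A + period (A + B) + (B + period (A + B)) = A + B := by
    rw [add_add_add_comm, ← add_assoc, add_period, add_period]
  rwa [h2] at h

/-! ### Representation counts -/

theorem addConvolution_eq_card_filter (A B : Finset G) (g : G) :
    A.addConvolution B g = (A.filter (fun a => g - a ∈ B)).card := by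
  rw [Finset.addConvolution]
  refine Finset.card_nbij' (fun p => p.1) (fun a => (a, g - a)) ?_ ?_ ?_ ?_
  · rintro ⟨a, b⟩ h
    simp only [Finset.mem_coe, Finset.mem_filter, Finset.mem_product] at h ⊢
    obtain ⟨⟨ha, hb⟩, rfl⟩ := h
    exact ⟨ha, by simpa using hb⟩
  · intro a h
    simp only [Finset.mem_coe, Finset.mem_filter, Finset.mem_product] at h ⊢
    exact ⟨h, by abel⟩
  · rintro ⟨a, b⟩ h
    simp only [Finset.mem_coe, Finset.mem_filter, Finset.mem_product] at h
    obtain ⟨-, rfl⟩ := h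
    simp
  · intro a _
    rfl

theorem addConvolution_comm (A B : Finset G) (g : G) :
    A.addConvolution B g = B.addConvolution A g := by
  rw [Finset.addConvolution, Finset.addConvolution]
  refine Finset.card_nbij' Prod.swap Prod.swap ?_ ?_ ?_ ?_
  · rintro ⟨a, b⟩ h
    simpa [add_comm, and_comm] using h
  · rintro ⟨a, b⟩ h
    simpa [add_comm, and_comm] using h
  · exact fun _ _ => rfl
  · exact fun _ _ => rfl

theorem addConvolution_mono {A A' B B' : Finset G} (hA : A' ⊆ A) (hB : B' ⊆ B) (g : G) :
    A'.addConvolution B' g ≤ A.addConvolution B g := by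
  rw [addConvolution_eq_card_filter, addConvolution_eq_card_filter]
  refine Finset.card_le_card fun a ha => ?_
  rw [Finset.mem_filter] at ha ⊢
  exact ⟨hA ha.1, hB ha.2⟩

theorem one_le_addConvolution {A B : Finset G} {a b : G} (ha : a ∈ A) (hb : b ∈ B) :
    1 ≤ A.addConvolution B (a + b) :=
  Finset.addConvolution_pos.2 (Finset.add_mem_add ha hb)

theorem two_le_addConvolution {A B : Finset G} {a b a' b' g : G} (ha : a ∈ A) (hb : b ∈ B)
    (ha' : a' ∈ A) (hb' : b' ∈ B) (hne : a ≠ a') (h : a + b = g) (h' : a' + b' = g) :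
    2 ≤ A.addConvolution B g := by
  rw [addConvolution_eq_card_filter]
  refine Finset.one_lt_card.2 ⟨a, ?_, a', ?_, hne⟩
  · exact Finset.mem_filter.2 ⟨ha, by simpa [← h] using hb⟩
  · exact Finset.mem_filter.2 ⟨ha', by simpa [← h'] using hb'⟩

theorem addConvolution_union_left {A A' : Finset G} (h : Disjoint A A') (B : Finset G) (g : G) :
    (A ∪ A').addConvolution B g = A.addConvolution B g + A'.addConvolution B g := by
  simp only [addConvolution_eq_card_filter]
  rw [Finset.filter_union, Finset.card_union_of_disjoint (Finset.disjoint_filter_filter h)]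

theorem addConvolution_union_right {B B' : Finset G} (h : Disjoint B B') (A : Finset G) (g : G) :
    A.addConvolution (B ∪ B') g = A.addConvolution B g + A.addConvolution B' g := by
  simp only [addConvolution_comm A]
  exact addConvolution_union_left h A g

/-- Pollard's identity for representation counts. -/
theorem addConvolution_eq_union_inter_add_sdiff (A B : Finset G) (g : G) :
    A.addConvolution B g = (A ∪ B).addConvolution (A ∩ B) g +
      (A \ B).addConvolution (B \ A) g := by
  have hA : A = A ∩ B ∪ A \ B := by rw [Finset.union_comm, Finset.sdiff_union_inter]
  have hB : B = A ∩ B ∪ B \ A := by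
    rw [Finset.union_comm, Finset.inter_comm, Finset.sdiff_union_inter]
  have hU : A ∪ B = A ∪ B \ A := (Finset.union_sdiff_self_eq_union).symm
  have hdB : Disjoint (A ∩ B) (B \ A) :=
    Finset.disjoint_sdiff.mono_left Finset.inter_subset_left
  have hdA : Disjoint (A ∩ B) (A \ B) :=
    Finset.disjoint_sdiff.mono_left Finset.inter_subset_right
  have h1 : A.addConvolution B g = A.addConvolution (A ∩ B) g + A.addConvolution (B \ A) g := by
    rw [← addConvolution_union_right hdB, ← hB]
  have h2 : A.addConvolution (B \ A) g =
      (A ∩ B).addConvolution (B \ A) g + (A \ B).addConvolution (B \ A) g := by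
    rw [← addConvolution_union_left hdA, ← hA]
  rw [hU, addConvolution_union_left Finset.disjoint_sdiff, h1, h2,
    addConvolution_comm (A ∩ B) (B \ A)]
  omega

theorem addConvolution_vadd_right (A B : Finset G) (x g : G) :
    A.addConvolution (x +ᵥ B) (x + g) = A.addConvolution B g := by
  rw [addConvolution_eq_card_filter, addConvolution_eq_card_filter]
  congr 1
  refine Finset.filter_congr fun a _ => ?_
  rw [add_sub_assoc, ← vadd_eq_add, Finset.vadd_mem_vadd_finset_iff]

/-- The number of representations, each element being counted at most twice. -/
def truncCount (A B : Finset G) : ℕ := ∑ g ∈ A + B, min 2 (A.addConvolution B g)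

theorem card_repSums_add_card_repSums (A B : Finset G) :
    (repSums A B 1).card + (repSums A B 2).card = truncCount A B := by
  rw [repSums, repSums, truncCount, Finset.card_filter, Finset.card_filter,
    ← Finset.sum_add_distrib]
  refine Finset.sum_congr rfl fun g _ => ?_
  split_ifs <;> omega

theorem truncCount_comm (A B : Finset G) : truncCount A B = truncCount B A := by
  simp only [truncCount, addConvolution_comm A B, add_comm A B]

theorem sum_le_truncCount (A B T : Finset G) :
    ∑ g ∈ T, min 2 (A.addConvolution B g) ≤ truncCount A B := by
  refine Finset.sum_le_sum_of_ne_zero fun g _ h => ?_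
  rw [← Finset.addConvolution_pos]
  omega

theorem truncCount_le_sum {A B A' B' : Finset G}
    (h : ∀ g, A'.addConvolution B' g ≤ A.addConvolution B g) :
    truncCount A' B' ≤ ∑ g ∈ A' + B', min 2 (A.addConvolution B g) :=
  Finset.sum_le_sum fun g _ => min_le_min le_rfl (h g)

theorem truncCount_vadd_right (A B : Finset G) (x : G) :
    truncCount A (x +ᵥ B) = truncCount A B := by
  have h : A + (x +ᵥ B) = (A + B).image (fun g => x + g) := by
    rw [add_vadd_comm]
    rfl
  rw [truncCount, h, Finset.sum_image fun _ _ _ _ h => add_left_cancel h]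
  simp only [addConvolution_vadd_right]
  rfl

theorem truncCount_eq_mul_of_card_le_two {A : Finset G} (hA : A.card ≤ 2) (B : Finset G) :
    truncCount A B = A.card * B.card := by
  rw [← Finset.card_product, Finset.card_eq_sum_card_fiberwise (f := fun p => p.1 + p.2)
    (t := A + B)]
  · refine Finset.sum_congr rfl fun g _ => ?_
    exact min_eq_right (Finset.addConvolution_le_card_left.trans hA)
  · rintro ⟨a, b⟩ h
    obtain ⟨ha, hb⟩ := Finset.mem_product.1 h
    exact Finset.add_mem_add ha hb

theorem card_add_card_le_sum {A B S T : Finset G} (hS : ∀ g ∈ S, 1 ≤ A.addConvolution B g)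
    (hT : ∀ g ∈ T, 1 ≤ A.addConvolution B g)
    (hST : ∀ g ∈ S, g ∈ T → 2 ≤ A.addConvolution B g) :
    S.card + T.card ≤ ∑ g ∈ S ∪ T, min 2 (A.addConvolution B g) := by
  have hS' : S.card = ∑ g ∈ S ∪ T, if g ∈ S then 1 else 0 := by
    rw [Finset.sum_boole, Finset.filter_mem_eq_inter, Finset.union_inter_cancel_left, Nat.cast_id]
  have hT' : T.card = ∑ g ∈ S ∪ T, if g ∈ T then 1 else 0 := by
    rw [Finset.sum_boole, Finset.filter_mem_eq_inter, Finset.union_inter_cancel_right, Nat.cast_id]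
  rw [hS', hT', ← Finset.sum_add_distrib]
  refine Finset.sum_le_sum fun g _ => ?_
  by_cases h1 : g ∈ S <;> by_cases h2 : g ∈ T <;> simp only [h1, h2, if_true, if_false]
  · have := hST g h1 h2
    omega
  · have := hS g h1
    omega
  · have := hT g h2
    omega
  · omega

theorem two_mul_card_le_sum {A B T : Finset G} (hT : ∀ g ∈ T, 1 ≤ A.addConvolution B g) :
    2 * T.card ≤ ∑ g ∈ T, min 2 (A.addConvolution B g) +
      (T.filter (fun g => A.addConvolution B g = 1)).card := by
  rw [Finset.card_filter, ← Finset.sum_add_distrib, mul_comm 2]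
  refine Finset.card_nsmul_le_sum T _ 2 fun g hg => ?_
  have := hT g hg
  split_ifs <;> omega

/-! ### Sumsets without unique expression elements -/

/-- Every element of `A + B` has at least two representations. -/
def NoUnique (A B : Finset G) : Prop := ∀ g ∈ A + B, 2 ≤ A.addConvolution B g

/-- After deleting at most one element from one of the two sets, every element of the sumset has
at least two representations. -/
def NearlyNoUnique (A B : Finset G) : Prop :=
  NoUnique A B ∨ (∃ a ∈ A, NoUnique (A.erase a) B) ∨ ∃ b ∈ B, NoUnique A (B.erase b)

theorem NoUnique.comm {A B : Finset G} (h : NoUnique A B) : NoUnique B A := fun g hg => by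
  rw [addConvolution_comm]
  exact h g (by rwa [add_comm])

theorem NearlyNoUnique.comm {A B : Finset G} (h : NearlyNoUnique A B) : NearlyNoUnique B A := by
  rcases h with h | ⟨a, ha, h⟩ | ⟨b, hb, h⟩
  · exact Or.inl h.comm
  · exact Or.inr (Or.inr ⟨a, ha, h.comm⟩)
  · exact Or.inr (Or.inl ⟨b, hb, h.comm⟩)

theorem NoUnique.of_vadd_right {A B : Finset G} {x : G} (h : NoUnique A (x +ᵥ B)) :
    NoUnique A B := fun g hg => by
  rw [← addConvolution_vadd_right A B x]
  refine h _ ?_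
  rw [add_vadd_comm]
  exact Finset.vadd_mem_vadd_finset hg

theorem NearlyNoUnique.of_vadd_right {A B : Finset G} {x : G} (h : NearlyNoUnique A (x +ᵥ B)) :
    NearlyNoUnique A B := by
  rcases h with h | ⟨a, ha, h⟩ | ⟨b, hb, h⟩
  · exact Or.inl h.of_vadd_right
  · exact Or.inr (Or.inl ⟨a, ha, h.of_vadd_right⟩)
  · obtain ⟨y, hy, rfl⟩ := Finset.mem_vadd_finset.1 hb
    refine Or.inr (Or.inr ⟨y, hy, NoUnique.of_vadd_right (x := x) ?_⟩)
    have he : x +ᵥ B.erase y = (x +ᵥ B).erase (x +ᵥ y) :=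
      Finset.image_erase (fun _ _ h => add_left_cancel h) B y
    rwa [he]

theorem NoUnique.of_add_subset {A B A' B' : Finset G} (h : NoUnique A' B') (hA : A' ⊆ A)
    (hB : B' ⊆ B) (hAB : A + B ⊆ A' + B') : NoUnique A B :=
  fun g hg => (h g (hAB hg)).trans (addConvolution_mono hA hB g)

theorem NoUnique.two_mul_card_add_sum_le {A B A' B' : Finset G} (h : NoUnique A' B')
    (hle : ∀ g, A'.addConvolution B' g ≤ A.addConvolution B g) {T : Finset G}
    (hT : Disjoint (A' + B') T) :
    2 * (A' + B').card + ∑ g ∈ T, min 2 (A.addConvolution B g) ≤ truncCount A B := by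
  refine le_trans ?_ (sum_le_truncCount A B ((A' + B') ∪ T))
  rw [Finset.sum_union hT, mul_comm]
  refine Nat.add_le_add_right (Finset.card_nsmul_le_sum _ _ _ fun g hg => ?_) _
  exact le_min le_rfl ((h g hg).trans (hle g))

/-- If a translate of `B` is not contained in `P`, then it has many elements outside of `P`. -/
theorem card_period_add_card_le {B P : Finset G} (hP : P.Nonempty) {a b : G} (hb : b ∈ B)
    (hab : a + b ∉ P) :
    (period P).card + B.card ≤ ((a +ᵥ B) \ P).card + (B + period P).card := by
  have h1 : ((b +ᵥ period P) ∩ B).card ≤ ((a +ᵥ B) \ P).card := by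
    rw [← Finset.card_vadd_finset a ((b +ᵥ period P) ∩ B)]
    refine Finset.card_le_card fun x hx => ?_
    obtain ⟨y, hy, rfl⟩ := Finset.mem_vadd_finset.1 hx
    obtain ⟨hyb, hyB⟩ := Finset.mem_inter.1 hy
    obtain ⟨z, hz, rfl⟩ := Finset.mem_vadd_finset.1 hyb
    refine Finset.mem_sdiff.2 ⟨Finset.vadd_mem_vadd_finset hyB, fun h => hab ?_⟩
    rw [vadd_eq_add, vadd_eq_add, ← add_assoc] at h
    exact (add_mem_iff_of_mem_period hz).1 h
  have h2 : ((b +ᵥ period P) ∪ B).card ≤ (B + period P).card := by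
    refine Finset.card_le_card (Finset.union_subset ?_ (subset_add_period B hP))
    intro x hx
    obtain ⟨z, hz, rfl⟩ := Finset.mem_vadd_finset.1 hx
    exact Finset.add_mem_add hb hz
  have h3 := Finset.card_union_add_card_inter (b +ᵥ period P) B
  rw [Finset.card_vadd_finset] at h3
  omega

/-- A sumset with a unique expression element has at least `|A| + |B| - 1` elements. -/
theorem noUnique_of_card_add_lt {A B : Finset G} (hA : A.Nonempty) (hB : B.Nonempty)
    (h : (A + B).card + 2 ≤ A.card + B.card) : NoUnique A B := by
  intro g hg
  obtain ⟨a, ha, b, hb, rfl⟩ := Finset.mem_add.1 hg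
  have hk := kneser hA hB
  set H := period (A + B) with hH
  have h1 : ((a +ᵥ H) ∪ A).card ≤ (A + H).card := by
    refine Finset.card_le_card (Finset.union_subset ?_ (subset_add_period A (hA.add hB)))
    intro x hx
    obtain ⟨z, hz, rfl⟩ := Finset.mem_vadd_finset.1 hx
    exact Finset.add_mem_add ha hz
  have h2 : ((b +ᵥ H) ∪ B).card ≤ (B + H).card := by
    refine Finset.card_le_card (Finset.union_subset ?_ (subset_add_period B (hA.add hB)))
    intro x hx
    obtain ⟨z, hz, rfl⟩ := Finset.mem_vadd_finset.1 hx
    exact Finset.add_mem_add hb hz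
  have h3 := Finset.card_union_add_card_inter (a +ᵥ H) A
  have h4 := Finset.card_union_add_card_inter (b +ᵥ H) B
  rw [Finset.card_vadd_finset] at h3 h4
  -- Pigeonhole in the coset a + H: both sets lie in it, and by Kneser their sizes add up to at
  -- least |H| + 2. Common points are representations of a + b.
  have h5 : (((a + b) +ᵥ -((b +ᵥ H) ∩ B)) ∪ ((a +ᵥ H) ∩ A)).card ≤ H.card := by
    rw [← Finset.card_vadd_finset a H]
    refine Finset.card_le_card (Finset.union_subset ?_ Finset.inter_subset_left)
    intro x hx
    obtain ⟨y, hy, rfl⟩ := Finset.mem_vadd_finset.1 hx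
    obtain ⟨hy, -⟩ := Finset.mem_inter.1 (Finset.mem_neg'.1 hy)
    obtain ⟨z, hz, hzy⟩ := Finset.mem_vadd_finset.1 hy
    refine Finset.mem_vadd_finset.2 ⟨-z, neg_mem_period hz, ?_⟩
    rw [vadd_eq_add] at hzy
    rw [vadd_eq_add, vadd_eq_add, ← neg_eq_iff_eq_neg.2 hzy]
    abel
  have h6 := Finset.card_union_add_card_inter ((a + b) +ᵥ -((b +ᵥ H) ∩ B)) ((a +ᵥ H) ∩ A)
  rw [Finset.card_vadd_finset, Finset.card_neg] at h6
  have h7 : (((a + b) +ᵥ -((b +ᵥ H) ∩ B)) ∩ ((a +ᵥ H) ∩ A)).card ≤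
      A.addConvolution B (a + b) := by
    rw [addConvolution_eq_card_filter]
    refine Finset.card_le_card fun x hx => ?_
    obtain ⟨hx1, hx2⟩ := Finset.mem_inter.1 hx
    refine Finset.mem_filter.2 ⟨(Finset.mem_inter.1 hx2).2, ?_⟩
    obtain ⟨y, hy, rfl⟩ := Finset.mem_vadd_finset.1 hx1
    have := (Finset.mem_inter.1 (Finset.mem_neg'.1 hy)).2
    simpa using this
  omega

/-! ### Restoring two deleted elements -/

theorem NoUnique.two_mul_card_add_card_add_card_le {A B A' B' : Finset G} (h : NoUnique A' B')
    (hA : A' ⊆ A) (hB : B' ⊆ B) {S T : Finset G} (hS : ∀ g ∈ S, 1 ≤ A.addConvolution B g)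
    (hT : ∀ g ∈ T, 1 ≤ A.addConvolution B g)
    (hST : ∀ g ∈ S, g ∈ T → 2 ≤ A.addConvolution B g) (hdS : Disjoint (A' + B') S)
    (hdT : Disjoint (A' + B') T) :
    2 * (A' + B').card + S.card + T.card ≤ truncCount A B := by
  have h1 := h.two_mul_card_add_sum_le (addConvolution_mono hA hB)
    (Finset.disjoint_union_right.2 ⟨hdS, hdT⟩)
  have h2 := card_add_card_le_sum hS hT hST
  omega

/-- If one deleted element can be restored without enlarging the sumset, only one deletion remains.
Otherwise both translates leave the sumset, and their new elements pay for the two copies of |H|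
lost in twice Kneser's bound. -/
theorem NoUnique.le_truncCount_or_of_erase_erase {A B : Finset G} {a b : G} (ha : a ∈ A)
    (hb : b ∈ B) (hA : 2 ≤ A.card) (hB : 2 ≤ B.card) (h : NoUnique (A.erase a) (B.erase b)) :
    2 * A.card + 2 * B.card ≤ truncCount A B + 4 ∨ NearlyNoUnique A B := by
  have hcA := Finset.card_erase_of_mem ha
  have hcB := Finset.card_erase_of_mem hb
  have hA0 : (A.erase a).Nonempty := Finset.card_pos.1 (by omega)
  have hB0 : (B.erase b).Nonempty := Finset.card_pos.1 (by omega)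
  by_cases h1 : ∀ y ∈ B.erase b, a + y ∈ A.erase a + B.erase b
  · refine Or.inr (Or.inr (Or.inr ⟨b, hb, h.of_add_subset (A.erase_subset a) subset_rfl ?_⟩))
    intro g hg
    obtain ⟨x, hx, y, hy, rfl⟩ := Finset.mem_add.1 hg
    by_cases hxa : x = a
    · rw [hxa]
      exact h1 y hy
    · exact Finset.add_mem_add (Finset.mem_erase.2 ⟨hxa, hx⟩) hy
  by_cases h2 : ∀ x ∈ A.erase a, b + x ∈ A.erase a + B.erase b
  · refine Or.inr (Or.inr (Or.inl ⟨a, ha, h.of_add_subset subset_rfl (B.erase_subset b) ?_⟩))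
    intro g hg
    obtain ⟨x, hx, y, hy, rfl⟩ := Finset.mem_add.1 hg
    by_cases hyb : y = b
    · rw [hyb, add_comm x b]
      exact h2 x hx
    · exact Finset.add_mem_add hx (Finset.mem_erase.2 ⟨hyb, hy⟩)
  push Not at h1 h2
  obtain ⟨y, hy, hay⟩ := h1
  obtain ⟨x, hx, hbx⟩ := h2
  left
  have hP := hA0.add hB0
  have hk := kneser hA0 hB0
  have h3 := card_period_add_card_le hP hy hay
  have h4 := card_period_add_card_le hP hx hbx
  have h5 := Finset.card_le_card (subset_add_period (A.erase a) hP)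
  have h6 := Finset.card_le_card (subset_add_period (B.erase b) hP)
  have h7 := h.two_mul_card_add_card_add_card_le (A.erase_subset a) (B.erase_subset b)
    (S := (a +ᵥ B.erase b) \ (A.erase a + B.erase b))
    (T := (b +ᵥ A.erase a) \ (A.erase a + B.erase b)) ?_ ?_ ?_
    Finset.disjoint_sdiff Finset.disjoint_sdiff
  · omega
  · intro g hg
    obtain ⟨z, hz, rfl⟩ := Finset.mem_vadd_finset.1 (Finset.mem_sdiff.1 hg).1
    exact one_le_addConvolution ha (Finset.mem_of_mem_erase hz)
  · intro g hg
    obtain ⟨z, hz, rfl⟩ := Finset.mem_vadd_finset.1 (Finset.mem_sdiff.1 hg).1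
    rw [vadd_eq_add, add_comm]
    exact one_le_addConvolution (Finset.mem_of_mem_erase hz) hb
  · intro g hg hg'
    obtain ⟨z, hz, hzg⟩ := Finset.mem_vadd_finset.1 (Finset.mem_sdiff.1 hg).1
    obtain ⟨w, hw, hwg⟩ := Finset.mem_vadd_finset.1 (Finset.mem_sdiff.1 hg').1
    exact two_le_addConvolution ha (Finset.mem_of_mem_erase hz) (Finset.mem_of_mem_erase hw) hb
      (Finset.ne_of_mem_erase hw).symm hzg (by rwa [add_comm])

theorem NoUnique.le_truncCount_or_of_erase_erase_left {A B : Finset G} {a a' : G} (ha : a ∈ A)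
    (ha' : a' ∈ A.erase a) (hA : 3 ≤ A.card) (hB : 2 ≤ B.card)
    (h : NoUnique ((A.erase a).erase a') B) :
    2 * A.card + 2 * B.card ≤ truncCount A B + 4 ∨ NearlyNoUnique A B := by
  have hcA := Finset.card_erase_of_mem ha
  have hcA' := Finset.card_erase_of_mem ha'
  have hne := Finset.ne_of_mem_erase ha'
  have ha'A := Finset.mem_of_mem_erase ha'
  have hA0 : ((A.erase a).erase a').Nonempty := Finset.card_pos.1 (by omega)
  have hB0 : B.Nonempty := Finset.card_pos.1 (by omega)
  have hsub : (A.erase a).erase a' ⊆ A := (Finset.erase_subset _ _).trans (Finset.erase_subset _ _)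
  by_cases h1 : ∀ y ∈ B, a + y ∈ (A.erase a).erase a' + B
  · refine Or.inr (Or.inr (Or.inl ⟨a', ha'A, h.of_add_subset ?_ subset_rfl ?_⟩))
    · exact Finset.erase_subset_erase _ (Finset.erase_subset _ _)
    intro g hg
    obtain ⟨x, hx, y, hy, rfl⟩ := Finset.mem_add.1 hg
    by_cases hxa : x = a
    · rw [hxa]
      exact h1 y hy
    · rw [Finset.mem_erase] at hx
      exact Finset.add_mem_add (Finset.mem_erase.2 ⟨hx.1, Finset.mem_erase.2 ⟨hxa, hx.2⟩⟩) hy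
  by_cases h2 : ∀ y ∈ B, a' + y ∈ (A.erase a).erase a' + B
  · refine Or.inr (Or.inr (Or.inl ⟨a, ha, h.of_add_subset (Finset.erase_subset _ _)
      subset_rfl ?_⟩))
    intro g hg
    obtain ⟨x, hx, y, hy, rfl⟩ := Finset.mem_add.1 hg
    by_cases hxa : x = a'
    · rw [hxa]
      exact h2 y hy
    · exact Finset.add_mem_add (Finset.mem_erase.2 ⟨hxa, hx⟩) hy
  push Not at h1 h2
  obtain ⟨y, hy, hay⟩ := h1
  obtain ⟨x, hx, hbx⟩ := h2
  left
  have hP := hA0.add hB0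
  have hk := kneser hA0 hB0
  have h3 := card_period_add_card_le hP hy hay
  have h4 := card_period_add_card_le hP hx hbx
  have h5 := Finset.card_le_card (subset_add_period ((A.erase a).erase a') hP)
  have h7 := h.two_mul_card_add_card_add_card_le hsub subset_rfl
    (S := (a +ᵥ B) \ ((A.erase a).erase a' + B)) (T := (a' +ᵥ B) \ ((A.erase a).erase a' + B))
    ?_ ?_ ?_ Finset.disjoint_sdiff Finset.disjoint_sdiff
  · omega
  · intro g hg
    obtain ⟨z, hz, rfl⟩ := Finset.mem_vadd_finset.1 (Finset.mem_sdiff.1 hg).1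
    exact one_le_addConvolution ha hz
  · intro g hg
    obtain ⟨z, hz, rfl⟩ := Finset.mem_vadd_finset.1 (Finset.mem_sdiff.1 hg).1
    exact one_le_addConvolution ha'A hz
  · intro g hg hg'
    obtain ⟨z, hz, hzg⟩ := Finset.mem_vadd_finset.1 (Finset.mem_sdiff.1 hg).1
    obtain ⟨w, hw, hwg⟩ := Finset.mem_vadd_finset.1 (Finset.mem_sdiff.1 hg').1
    exact two_le_addConvolution ha hz ha'A hw hne.symm hzg hwg

/-! ### The dichotomy -/

theorem eq_of_addConvolution_eq_one {A B : Finset G} {a b : G} (hA : 2 ≤ A.card) (hB : 2 ≤ B.card)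
    (ih : ∀ A' B' : Finset G, 2 ≤ A'.card → 2 ≤ B'.card → A'.card * B'.card < A.card * B.card →
      2 * A'.card + 2 * B'.card ≤ truncCount A' B' + 4 ∨ NearlyNoUnique A' B')
    (hN : truncCount A B + 4 < 2 * A.card + 2 * B.card) (hn : ¬ NearlyNoUnique A B) {b' : G}
    (ha : a ∈ A) (hb : b ∈ B) (hb' : b' ∈ B) (h : A.addConvolution B (a + b) = 1)
    (h' : A.addConvolution B (a + b') = 1) : b = b' := by
  by_contra hne
  -- For |A| = 2 no count is truncated, so N = 2|B| meets the bound exactly.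
  have hA3 : 3 ≤ A.card := by
    by_contra hA3
    rw [truncCount_eq_mul_of_card_le_two (by omega), show A.card = 2 by omega] at hN
    omega
  have hc := Finset.card_erase_of_mem ha
  have hnot : ∀ y ∈ B, A.addConvolution B (a + y) = 1 → a + y ∉ A.erase a + B := by
    intro y hy hay hmem
    obtain ⟨x, hx, z, hz, hxz⟩ := Finset.mem_add.1 hmem
    have := two_le_addConvolution ha hy (Finset.mem_of_mem_erase hx) hz
      (Finset.ne_of_mem_erase hx).symm rfl hxz
    omega
  -- Both unique expression elements disappear with a, which matches the loss of 2 in 2|A|.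
  have h1 : truncCount (A.erase a) B + 2 ≤ truncCount A B := by
    have h2 := sum_le_truncCount A B (insert (a + b) (insert (a + b') (A.erase a + B)))
    rw [Finset.sum_insert, Finset.sum_insert (hnot b' hb' h'), h, h'] at h2
    · have h3 : truncCount (A.erase a) B ≤ _ := truncCount_le_sum
        (addConvolution_mono (A.erase_subset a) (subset_refl B))
      omega
    · rw [Finset.mem_insert, not_or]
      exact ⟨fun h => hne (add_left_cancel h), hnot b hb h⟩
  have h4 := ih (A.erase a) B (by omega) hB
    (Nat.mul_lt_mul_of_pos_right (by omega) (by omega))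
  rcases h4 with h4 | h4 | ⟨a', ha', h4⟩ | ⟨y, hy, h4⟩
  · omega
  · exact hn (Or.inr (Or.inl ⟨a, ha, h4⟩))
  · rcases h4.le_truncCount_or_of_erase_erase_left ha ha' hA3 hB with h5 | h5
    · omega
    · exact hn h5
  · rcases h4.le_truncCount_or_of_erase_erase ha hy hA hB with h5 | h5
    · omega
    · exact hn h5

/-- The induction step, for a pair that has been translated into a suitable position. -/
theorem false_of_unique_add {A B : Finset G} {a c : G} (hA : 2 ≤ A.card) (hB : 2 ≤ B.card)
    (hBA : B.card ≤ A.card)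
    (ih : ∀ A' B' : Finset G, 2 ≤ A'.card → 2 ≤ B'.card → A'.card * B'.card < A.card * B.card →
      2 * A'.card + 2 * B'.card ≤ truncCount A' B' + 4 ∨ NearlyNoUnique A' B')
    (hN : truncCount A B + 4 < 2 * A.card + 2 * B.card) (hn : ¬ NearlyNoUnique A B)
    (ha : a ∈ A) (hcA : c ∈ A) (hcB : c ∈ B) (hac : A.addConvolution B (a + c) = 1)
    (hsub : ¬ B ⊆ A) : False := by
  have hrow : ∀ x ∈ A, ∀ y ∈ B, ∀ y' ∈ B, A.addConvolution B (x + y) = 1 →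
      A.addConvolution B (x + y') = 1 → y = y' := fun x hx y hy y' hy' =>
    eq_of_addConvolution_eq_one hA hB ih hN hn hx hy hy'
  have hcol : ∀ y ∈ B, ∀ x ∈ A, ∀ x' ∈ A, A.addConvolution B (x + y) = 1 →
      A.addConvolution B (x' + y) = 1 → x = x' := fun y hy x hx x' hx' h h' => by
    rw [addConvolution_comm, add_comm] at h h'
    refine eq_of_addConvolution_eq_one hB hA ?_ ?_ ?_ hy hx hx' h h'
    · rw [mul_comm]
      exact ih
    · rw [truncCount_comm]
      omega
    · exact fun h => hn h.comm
  have hcard := Finset.card_union_add_card_inter A B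
  have hIB : (A ∩ B).card < B.card := Finset.card_lt_card
    (Finset.ssubset_iff_subset_ne.2 ⟨Finset.inter_subset_right,
      fun h => hsub (Finset.inter_eq_right.1 h)⟩)
  have hcI : c ∈ A ∩ B := Finset.mem_inter.2 ⟨hcA, hcB⟩
  have hIpos := Finset.card_pos.2 ⟨c, hcI⟩
  have hdy := addConvolution_eq_union_inter_add_sdiff A B
  have haU : a ∈ A ∪ B := Finset.mem_union_left _ ha
  rcases Nat.lt_or_ge (A ∩ B).card 2 with hI | hI
  · -- the intersection is a single element
    have hI1 : A ∩ B = {c} := by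
      obtain ⟨z, hz⟩ := Finset.card_eq_one.1 (show (A ∩ B).card = 1 by omega)
      rw [hz, Finset.mem_singleton] at hcI
      rw [hz, hcI]
    have hA0 : A \ B = A.erase c := by
      rw [← Finset.sdiff_inter_self_left, hI1, Finset.sdiff_singleton_eq_erase]
    have hB0 : B \ A = B.erase c := by
      rw [← Finset.sdiff_inter_self_left, Finset.inter_comm, hI1, Finset.sdiff_singleton_eq_erase]
    have hcA' := Finset.card_erase_of_mem hcA
    have hcB' := Finset.card_erase_of_mem hcB
    -- Here |A ∪ B| = |A| + |B| - 1, so failure of the bound forces |(A \ c) + (B \ c)| ≤ |A| + |B|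
    -- - 4, small enough to exclude unique expression elements.
    have h1 : (c +ᵥ (A ∪ B)).card + (A.erase c + B.erase c).card ≤ truncCount A B := by
      refine (card_add_card_le_sum ?_ ?_ ?_).trans (sum_le_truncCount A B _)
      · intro g hg
        obtain ⟨z, hz, rfl⟩ := Finset.mem_vadd_finset.1 hg
        have := one_le_addConvolution hz hcI
        rw [vadd_eq_add, add_comm, hdy]
        omega
      · intro g hg
        rw [← hA0, ← hB0, ← Finset.addConvolution_pos] at hg
        rw [hdy]
        omega
      · intro g hg hg'
        obtain ⟨z, hz, rfl⟩ := Finset.mem_vadd_finset.1 hg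
        have := one_le_addConvolution hz hcI
        rw [← hA0, ← hB0, ← Finset.addConvolution_pos] at hg'
        rw [vadd_eq_add, add_comm] at hg' ⊢
        rw [hdy]
        omega
    rw [Finset.card_vadd_finset] at h1
    have h2 : NoUnique (A.erase c) (B.erase c) := noUnique_of_card_add_lt
      (Finset.card_pos.1 (by omega)) (Finset.card_pos.1 (by omega)) (by omega)
    rcases h2.le_truncCount_or_of_erase_erase hcA hcB hA hB with h5 | h5
    · omega
    · exact hn h5
  have hmono : ∀ g, (A ∪ B).addConvolution (A ∩ B) g ≤ A.addConvolution B g := fun g => by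
    rw [hdy g]
    omega
  have hlt : (A ∪ B).card * (A ∩ B).card < A.card * B.card := by
    obtain ⟨p, hp⟩ := Nat.exists_eq_add_of_lt hIB
    obtain ⟨q, hq⟩ := Nat.exists_eq_add_of_le hBA
    have hu : (A ∪ B).card = (A ∩ B).card + p + 1 + (p + 1 + q) := by omega
    rw [hu, hq, hp]
    nlinarith
  -- The uniqueness of a + c passes to the transformed pair, so any deletion there must remove a or
  -- c.
  have huniq : ∀ X ⊆ A ∪ B, ∀ Y ⊆ A ∩ B, NoUnique X Y → a + c ∉ X + Y := by
    intro X hX Y hY h hmem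
    have h1 := h _ hmem
    have h2 := addConvolution_mono hX hY (a + c)
    have h3 := hmono (a + c)
    omega
  rcases ih (A ∪ B) (A ∩ B) (by omega) hI hlt with h | h | ⟨u, hu, h⟩ | ⟨i, hi, h⟩
  · have : truncCount (A ∪ B) (A ∩ B) ≤ truncCount A B :=
      (truncCount_le_sum hmono).trans (sum_le_truncCount A B _)
    omega
  · exact huniq _ subset_rfl _ subset_rfl h (Finset.add_mem_add haU hcI)
  · have hP := huniq _ (Finset.erase_subset _ _) _ subset_rfl h
    have hua : u = a := by
      by_contra hne
      exact hP (Finset.add_mem_add (Finset.mem_erase.2 ⟨fun h => hne h.symm, haU⟩) hcI)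
    subst hua
    have hc := Finset.card_erase_of_mem hu
    have hU0 : ((A ∪ B).erase u).Nonempty := Finset.card_pos.1 (by omega)
    have hI0 : (A ∩ B).Nonempty := ⟨c, hcI⟩
    have hk := kneser hU0 hI0
    have h1 := card_period_add_card_le (hU0.add hI0) hcI hP
    have h2 := Finset.card_le_card (subset_add_period ((A ∪ B).erase u) (hU0.add hI0))
    set P := (A ∪ B).erase u + (A ∩ B) with hPdef
    have h3 : ∀ g ∈ (u +ᵥ (A ∩ B)) \ P, 1 ≤ A.addConvolution B g := by
      intro g hg
      obtain ⟨z, hz, rfl⟩ := Finset.mem_vadd_finset.1 (Finset.mem_sdiff.1 hg).1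
      exact one_le_addConvolution ha (Finset.mem_inter.1 hz).2
    have h4 := two_mul_card_le_sum h3
    -- All new elements lie in the row of a, where only a + c is unique: the count is 2|A| + 2|B| -
    -- 3 or more.
    have h5 : (((u +ᵥ (A ∩ B)) \ P).filter (fun g => A.addConvolution B g = 1)).card ≤ 1 := by
      refine Finset.card_le_one_iff_subset_singleton.2 ⟨u + c, fun g hg => ?_⟩
      obtain ⟨hg, hg1⟩ := Finset.mem_filter.1 hg
      obtain ⟨z, hz, rfl⟩ := Finset.mem_vadd_finset.1 (Finset.mem_sdiff.1 hg).1
      rw [hrow u ha z (Finset.mem_inter.1 hz).2 c hcB hg1 hac]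
      exact Finset.mem_singleton_self _
    have h6 : 2 * P.card + ∑ g ∈ (u +ᵥ (A ∩ B)) \ P, min 2 (A.addConvolution B g) ≤
        truncCount A B := by
      exact h.two_mul_card_add_sum_le (fun g => (addConvolution_mono (Finset.erase_subset _ _)
        subset_rfl g).trans (hmono g)) Finset.disjoint_sdiff
    omega
  · have hP := huniq _ subset_rfl _ (Finset.erase_subset _ _) h
    have hic : i = c := by
      by_contra hne
      exact hP (Finset.add_mem_add haU (Finset.mem_erase.2 ⟨fun h => hne h.symm, hcI⟩))
    subst hic
    have hc := Finset.card_erase_of_mem hi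
    have hU0 : (A ∪ B).Nonempty := ⟨a, haU⟩
    have hI0 : ((A ∩ B).erase i).Nonempty := Finset.card_pos.1 (by omega)
    have hk := kneser hU0 hI0
    have h1 := card_period_add_card_le (hU0.add hI0) haU (by rwa [add_comm i a])
    have h2 := Finset.card_le_card (subset_add_period ((A ∩ B).erase i) (hU0.add hI0))
    set P := (A ∪ B) + (A ∩ B).erase i with hPdef
    have h3 : ∀ g ∈ (i +ᵥ (A ∪ B)) \ P, 1 ≤ A.addConvolution B g := by
      intro g hg
      obtain ⟨z, hz, rfl⟩ := Finset.mem_vadd_finset.1 (Finset.mem_sdiff.1 hg).1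
      rw [vadd_eq_add, add_comm]
      exact (one_le_addConvolution hz hcI).trans (hmono _)
    have h4 := two_mul_card_le_sum h3
    -- One unique element from the column c + A and one from the row c + B: a loss of 2, still
    -- within the allowed 4.
    have h5 : (((i +ᵥ (A ∪ B)) \ P).filter (fun g => A.addConvolution B g = 1)).card ≤ 2 := by
      have h6 : ((i +ᵥ B).filter (fun g => A.addConvolution B g = 1)).card ≤ 1 := by
        refine Finset.card_le_one.2 fun g hg g' hg' => ?_
        obtain ⟨hg, hg1⟩ := Finset.mem_filter.1 hg
        obtain ⟨hg', hg1'⟩ := Finset.mem_filter.1 hg'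
        obtain ⟨z, hz, rfl⟩ := Finset.mem_vadd_finset.1 hg
        obtain ⟨z', hz', rfl⟩ := Finset.mem_vadd_finset.1 hg'
        rw [hrow i hcA z hz z' hz' hg1 hg1']
      have h7 : ((i +ᵥ A).filter (fun g => A.addConvolution B g = 1)).card ≤ 1 := by
        refine Finset.card_le_one.2 fun g hg g' hg' => ?_
        obtain ⟨hg, hg1⟩ := Finset.mem_filter.1 hg
        obtain ⟨hg', hg1'⟩ := Finset.mem_filter.1 hg'
        obtain ⟨z, hz, rfl⟩ := Finset.mem_vadd_finset.1 hg
        obtain ⟨z', hz', rfl⟩ := Finset.mem_vadd_finset.1 hg'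
        rw [vadd_eq_add, add_comm] at hg1 hg1'
        rw [hcol i hcB z hz z' hz' hg1 hg1']
      refine (Finset.card_le_card ?_).trans ((Finset.card_union_le _ _).trans
        (Nat.add_le_add h7 h6))
      rw [← Finset.filter_union, ← Finset.vadd_finset_union]
      exact Finset.filter_subset_filter _ Finset.sdiff_subset
    have h6 : 2 * P.card + ∑ g ∈ (i +ᵥ (A ∪ B)) \ P, min 2 (A.addConvolution B g) ≤
        truncCount A B := by
      exact h.two_mul_card_add_sum_le (fun g => (addConvolution_mono subset_rfl
        (Finset.erase_subset _ _) g).trans (hmono g)) Finset.disjoint_sdiff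
    omega

theorem le_truncCount_or_nearlyNoUnique (A B : Finset G) (hA : 2 ≤ A.card) (hB : 2 ≤ B.card) :
    2 * A.card + 2 * B.card ≤ truncCount A B + 4 ∨ NearlyNoUnique A B := by
  induction hm : A.card * B.card using Nat.strong_induction_on generalizing A B with
  | _ m ih =>
    wlog hBA : B.card ≤ A.card generalizing A B
    · rcases this B A hB hA (by rw [mul_comm, hm]) (by omega) with h | h
      · left
        rw [truncCount_comm]
        omega
      · exact Or.inr h.comm
    by_contra! hcon
    obtain ⟨hN, hn⟩ := hcon
    have hnf : ¬ NoUnique A B := fun h => hn (Or.inl h)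
    unfold NoUnique at hnf
    push Not at hnf
    obtain ⟨g, hg, hg2⟩ := hnf
    have hg1 : A.addConvolution B g = 1 := by
      have := Finset.addConvolution_pos.2 hg
      omega
    obtain ⟨a, ha, b, hb, rfl⟩ := Finset.mem_add.1 hg
    -- If every such translate of B lay in A, then b' - b would stabilize A for some b' ≠ b, giving
    -- a + b a second representation.
    obtain ⟨x, hx, hxB⟩ : ∃ x ∈ A, ¬ (x - b) +ᵥ B ⊆ A := by
      by_contra! hall
      obtain ⟨b', hb', hne⟩ := Finset.exists_mem_ne (show 1 < B.card by omega) b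
      have himg : (b' - b) +ᵥ A = A := by
        refine Finset.eq_of_subset_of_card_le (fun y hy => ?_) (by simp)
        obtain ⟨z, hz, rfl⟩ := Finset.mem_vadd_finset.1 hy
        refine hall z hz (Finset.mem_vadd_finset.2 ⟨b', hb', ?_⟩)
        rw [vadd_eq_add, vadd_eq_add]
        abel
      have ha' := ha
      rw [← himg] at ha'
      obtain ⟨z, hz, hza⟩ := Finset.mem_vadd_finset.1 ha'
      have h2 : z + b' = a + b := by
        rw [← hza, vadd_eq_add]
        abel
      have hza' : a ≠ z := fun h => hne (by rw [h] at h2; exact add_left_cancel h2)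
      have := two_le_addConvolution ha hb hz hb' hza' rfl h2
      omega
    refine false_of_unique_add (A := A) (B := (x - b) +ᵥ B) (a := a) (c := x) hA ?_ ?_ ?_ ?_ ?_
      ha hx ?_ ?_ hxB
    · simpa using hB
    · simpa using hBA
    · rw [Finset.card_vadd_finset]
      exact fun A' B' h1 h2 h3 => ih _ (by omega) A' B' h1 h2 rfl
    · rw [Finset.card_vadd_finset, truncCount_vadd_right]
      exact hN
    · exact fun h => hn h.of_vadd_right
    · exact Finset.mem_vadd_finset.2 ⟨b, hb, by rw [vadd_eq_add]; abel⟩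
    · rw [← hg1, ← addConvolution_vadd_right A B (x - b)]
      congr 1
      abel

/-! ### The structure of the exceptional pairs -/

theorem mem_stab_iff_mem_period {S : Finset G} (hS : S.Nonempty) (x : G) :
    x ∈ stab S ↔ x ∈ period S := by
  refine ⟨fun h => (mem_period hS).2 fun s hs => ?_, fun h => vadd_eq_of_mem_period h⟩
  have h1 : x +ᵥ S = S := h
  have h2 := Finset.vadd_mem_vadd_finset (a := x) hs
  rwa [h1] at h2

theorem coe_stab {S : Finset G} (hS : S.Nonempty) : (stab S : Set G) = (period S : Set G) :=
  Set.ext fun x => mem_stab_iff_mem_period hS x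

theorem natCard_stab {S : Finset G} (hS : S.Nonempty) :
    Nat.card (stab S) = (period S).card := by
  rw [← Set.ncard_coe_finset, ← coe_stab hS]
  rfl

theorem holes_stab {S : Finset G} (hS : S.Nonempty) (A : Finset G) :
    holes (stab S) A = ((A + period S).card : ℤ) - (A.card : ℤ) := by
  rw [holes, coe_stab hS, ← Finset.coe_add, Set.ncard_coe_finset]

theorem NoUnique.repSums_eq {A B : Finset G} (h : NoUnique A B) : repSums A B 2 = A + B :=
  Finset.filter_true_of_mem h

/-- If the deleted elements only contribute unique expression elements, then `A' + B'` is the set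
of all elements with two representations. -/
theorem NoUnique.repSums_eq_of_subset {A B A' B' : Finset G} (h : NoUnique A' B') (hA : A' ⊆ A)
    (hB : B' ⊆ B) (hu : ∀ g, 2 ≤ A.addConvolution B g → g ∈ A' + B') :
    repSums A B 2 = A' + B' := by
  ext g
  rw [mem_repSums A B (by norm_num)]
  exact ⟨hu g, fun hg => (h g hg).trans (addConvolution_mono hA hB g)⟩

theorem two_le_addConvolution_erase_left {A B : Finset G} {a g : G}
    (h : 2 ≤ A.addConvolution B g) : g ∈ A.erase a + B := by
  rw [addConvolution_eq_card_filter] at h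
  obtain ⟨x, hx, hne⟩ := Finset.exists_mem_ne (Nat.lt_of_succ_le h) a
  obtain ⟨hxA, hxB⟩ := Finset.mem_filter.1 hx
  exact Finset.mem_add.2 ⟨x, Finset.mem_erase.2 ⟨hne, hxA⟩, g - x, hxB, by abel⟩

/-- Twice Kneser's bound for the remaining sumset, plus the new elements of the translate a + B,
each counted once. -/
theorem NoUnique.card_erase_add_le {A B : Finset G} {a : G} (ha : a ∈ A) (hA : 2 ≤ A.card)
    (hB : B.Nonempty) (h : NoUnique (A.erase a) B) (hsub : ¬ A + B ⊆ A.erase a + B) :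
    2 * (A.erase a + period (A.erase a + B)).card + (B + period (A.erase a + B)).card + B.card ≤
      truncCount A B + (period (A.erase a + B)).card := by
  have hc := Finset.card_erase_of_mem ha
  have hA0 : (A.erase a).Nonempty := Finset.card_pos.1 (by omega)
  have hk := kneser hA0 hB
  obtain ⟨b, hb, hab⟩ : ∃ b ∈ B, a + b ∉ A.erase a + B := by
    by_contra! hall
    refine hsub fun g hg => ?_
    obtain ⟨x, hx, y, hy, rfl⟩ := Finset.mem_add.1 hg
    by_cases hxa : x = a
    · rw [hxa]
      exact hall y hy
    · exact Finset.add_mem_add (Finset.mem_erase.2 ⟨hxa, hx⟩) hy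
  have h1 := card_period_add_card_le (hA0.add hB) hb hab
  have h2 := h.two_mul_card_add_card_add_card_le (A.erase_subset a) subset_rfl
    (S := (a +ᵥ B) \ (A.erase a + B)) (T := ∅) ?_ (by simp) (by simp) Finset.disjoint_sdiff
    (by simp)
  · rw [Finset.card_empty] at h2
    omega
  · intro g hg
    obtain ⟨z, hz, rfl⟩ := Finset.mem_vadd_finset.1 (Finset.mem_sdiff.1 hg).1
    exact one_le_addConvolution ha hz

theorem stab_ne_bot {S : Finset G} (hS : S.Nonempty) (h : (period S).card ≠ 1) :
    stab S ≠ ⊥ := fun hb => h (by rw [← natCard_stab hS, hb]; simp)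

end Pollard

/-! ### Assembly of the theorem -/

open Pollard in
theorem theorem2 {G : Type*} [AddCommGroup G] [DecidableEq G] (A B : Finset G)
    (hA : 2 ≤ A.card) (hB : 2 ≤ B.card) :
    ((Pollard.repSums A B 1).card : ℤ) + ((Pollard.repSums A B 2).card : ℤ)
        ≥ 2 * (A.card : ℤ) + 2 * (B.card : ℤ) - 4 ∨
    ∃ A' ⊆ A, ∃ B' ⊆ B, ∃ (H : AddSubgroup G) (l ρ : ℤ),
      H = Pollard.stab (Pollard.repSums A B 2) ∧
      H ≠ ⊥ ∧
      l = ((A \ A').card : ℤ) + ((B \ B').card : ℤ) ∧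
      ρ = Pollard.holes H A' + Pollard.holes H B' ∧
      l ≤ 1 ∧
      Pollard.repSums A' B' 2 = A' + B' ∧
      A' + B' = Pollard.repSums A B 2 ∧
      ((Pollard.repSums A B 1).card : ℤ) + ((Pollard.repSums A B 2).card : ℤ)
        ≥ 2 * (A.card : ℤ) + 2 * (B.card : ℤ) - (2 - l) * ((Nat.card H : ℤ) - ρ) - 2 * l ∧
      2 * (A.card : ℤ) + 2 * (B.card : ℤ) - (2 - l) * ((Nat.card H : ℤ) - ρ) - 2 * l
        ≥ 2 * (A.card : ℤ) + 2 * (B.card : ℤ) - 2 * (Nat.card H : ℤ) := by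
  rw [← Nat.cast_add, card_repSums_add_card_repSums]
  have hA0 : A.Nonempty := Finset.card_pos.1 (by omega)
  have hB0 : B.Nonempty := Finset.card_pos.1 (by omega)
  by_cases hN : 2 * A.card + 2 * B.card ≤ truncCount A B + 4
  · left
    omega
  right
  have hnn := (le_truncCount_or_nearlyNoUnique A B hA hB).resolve_left hN
  by_cases hn : NoUnique A B
  · have hS := hA0.add hB0
    have hk := kneser hA0 hB0
    have h1 := hn.two_mul_card_add_sum_le (fun _ => le_rfl) (Finset.disjoint_empty_right _)
    have h2 := Finset.card_le_card (subset_add_period A hS)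
    have h3 := Finset.card_le_card (subset_add_period B hS)
    rw [Finset.sum_empty] at h1
    refine ⟨A, subset_rfl, B, subset_rfl, _, 0, _, rfl, ?_, by simp, rfl, by norm_num,
      hn.repSums_eq, hn.repSums_eq.symm, ?_, ?_⟩ <;> rw [hn.repSums_eq]
    · exact stab_ne_bot hS (by omega)
    all_goals
      rw [holes_stab hS, holes_stab hS, natCard_stab hS]
      omega
  rcases hnn with h | ⟨a, ha, h⟩ | ⟨b, hb, h⟩
  · exact absurd h hn
  · have hc := Finset.card_erase_of_mem ha
    have hS : (A.erase a + B).Nonempty := (Finset.card_pos.1 (by omega)).add hB0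
    have hr : repSums A B 2 = A.erase a + B := h.repSums_eq_of_subset (A.erase_subset a)
      subset_rfl fun g => two_le_addConvolution_erase_left
    have h1 := h.card_erase_add_le ha hA hB0
      fun hs => hn (h.of_add_subset (A.erase_subset a) subset_rfl hs)
    have h2 := Finset.card_le_card (subset_add_period (A.erase a) hS)
    have h3 := Finset.card_le_card (subset_add_period B hS)
    -- A trivial stabilizer would give the first alternative. Hence |H| ≥ 2, which for l = 1 is also
    -- what the last inequality needs.
    have h4 : (period (A.erase a + B)).card ≠ 1 := by omega
    have h5 := Finset.card_pos.2 (period_nonempty hS)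
    refine ⟨A.erase a, A.erase_subset a, B, subset_rfl, _, 1, _, rfl, ?_, ?_, rfl, le_rfl,
      h.repSums_eq, hr.symm, ?_, ?_⟩
    · rw [hr]
      exact stab_ne_bot hS h4
    · rw [Finset.sdiff_erase_self ha]
      simp
    all_goals
      rw [hr, holes_stab hS, holes_stab hS, natCard_stab hS]
      omega
  · have hc := Finset.card_erase_of_mem hb
    have hS : (A + B.erase b).Nonempty := hA0.add (Finset.card_pos.1 (by omega))
    have hr : repSums A B 2 = A + B.erase b := h.repSums_eq_of_subset subset_rfl
      (B.erase_subset b) fun g hg => by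
        rw [addConvolution_comm] at hg
        rw [add_comm A]
        exact two_le_addConvolution_erase_left hg
    have h1 := h.comm.card_erase_add_le hb hB hA0
      fun hs => hn (h.comm.of_add_subset (B.erase_subset b) subset_rfl hs).comm
    rw [truncCount_comm B A, add_comm (B.erase b) A] at h1
    have h2 := Finset.card_le_card (subset_add_period A hS)
    have h3 := Finset.card_le_card (subset_add_period (B.erase b) hS)
    have h4 : (period (A + B.erase b)).card ≠ 1 := by omega
    have h5 := Finset.card_pos.2 (period_nonempty hS)
    refine ⟨A, subset_rfl, B.erase b, B.erase_subset b, _, 1, _, rfl, ?_, ?_, rfl, le_rfl,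
      h.repSums_eq, hr.symm, ?_, ?_⟩
    · rw [hr]
      exact stab_ne_bot hS h4
    · rw [Finset.sdiff_erase_self hb]
      simp
    all_goals
      rw [hr, holes_stab hS, holes_stab hS, natCard_stab hS]
      omega
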